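/- Let $n\ge 1$, $r\ge 1$, let $p$ divide $r$, put $d=r/p$, let $0\ne q\in\mathbb C$ and let $\xi\in\mathbb C$ be a primitive $p$-th root of unity. Let $v_0,\dots,v_{d-1}\in\mathbb C$ be nonzero, and for $1\le j\le r$ put $u_j=\xi^k v_l$ if $j-1=lp+k$ with $0\le k\le p-1$, $0\le l\le d-1$; thus all $u_j$ are nonzero. Let $\mathcal H_{r,1,n}=\mathcal H_{r,1,n}(u_1,\dots,u_r,q)$ be the $\mathbb C$-algebra with generators $T_1,\dots,T_n$ and relations: (1) $T_iT_j=T_jT_i$ if $|i-j|>1$; (2) $T_iT_{i+1}T_i=T_{i+1}T_iT_{i+1}$ for $2\le i\le n-1$; (3) $T_1T_2T_1T_2=T_2T_1T_2T_1$ (if $n\ge2$); (4) $(T_1-u_1)\cdots(T_1-u_r)=0$; (5) $(T_i-1)(T_i+q)=0$ for $2\le i\le n$. As the $u_j$ are nonzero, $T_1$ is invertible. Let $\mathcal H_{r,p,n}$ be the subalgebra of $\mathcal H_{r,1,n}$ generated by $T_1^p$, $T_1^{-1}T_2T_1$ (if $n\ge 2$) and $T_i$ for $2\le i\le n$. Let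 $\mathcal H_{\infty,1,n}=\mathcal H_{\infty,1,n}(q)$ be the affine Hecke algebra, generated by $X^{\pm1},T_2,\dots,T_n$ with the relations (1), (2), (3), (5), where $X$ replaces $T_1$, and $XX^{-1}=X^{-1}X=1$. Let $\mathcal H_{\infty,p,n}$ be its subalgebra generated by $X^{\pm p}$, $X^{-1}T_2X$ (if $n\ge2$) and $T_i$ for $2\le i\le n$. Let $\phi:\mathcal H_{\infty,1,n}\to\mathcal H_{r,1,n}$ be the quotient map $X\mapsto T_1$, $T_i\mapsto T_i$ $(i\ge 2)$, and let $\tau_\infty$ be the automorphism of $\mathcal H_{\infty,1,n}$ with $\tau_\infty(X)=\xi X$ and $\tau_\infty(T_i)=T_i$ for $2\le i\le n$. Then: (a) $\prod_{j=1}^r(t-u_j)=\prod_{l=0}^{d-1}(t^p-v_l^p)$ in $\mathbb C[t]$, so relation (4) reads $\prod_{l=0}^{d-1}(T_1^p-v_l^p)=0$. (b) There is an algebra automorphism $\tau$ of $\mathcal H_{r,1,n}$ with $\tau(T_1)=\xi T_1$ and $\tau(T_i)=T_i$ for $2\le i\le n$, and it is the only algebra endomorphism with these values. It has order exactly $p$,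 and so does $\tau_\infty$. (c) $1\mapsto\tau$ defines a faithful action of $\mathbb Z/p\mathbb Z$ on $\mathcal H_{r,1,n}$ by algebra automorphisms, and $\mathcal H_{r,p,n}=(\mathcal H_{r,1,n})^{\mathbb Z/p\mathbb Z}$. (d) $\phi$ restricts to a surjective homomorphism $\mathcal H_{\infty,p,n}\to\mathcal H_{r,p,n}$, and $\tau\circ\phi=\phi\circ\tau_\infty$; that is, the diagram $$\begin{array}{ccccc}\mathcal H_{\infty,p,n}&\hookrightarrow&\mathcal H_{\infty,1,n}&\xrightarrow{\ \tau_\infty\ }&\mathcal H_{\infty,1,n}\\ \downarrow\phi&&\downarrow\phi&&\downarrow\phi\\ \mathcal H_{r,p,n}&\hookrightarrow&\mathcal H_{r,1,n}&\xrightarrow{\ \tau\ }&\mathcal H_{r,1,n}\end{array}$$ commutes. -/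

import Mathlib

open Polynomial

noncomputable section

namespace CycloHecke

/-- The relations shared by the cyclotomic and the affine Hecke algebras, imposed on a family
`T_1, …, T_n` of elements of a complex algebra. The element `T_i` is `T ⟨i - 1, _⟩`, so `T 0` is
`T_1` (called `X` in the affine case):
`T_i T_j = T_j T_i` for `|i - j| > 1`; `T_i T_{i+1} T_i = T_{i+1} T_i T_{i+1}` for
`2 ≤ i ≤ n - 1`; `T_1 T_2 T_1 T_2 = T_2 T_1 T_2 T_1`; `(T_i - 1)(T_i + q) = 0` for `2 ≤ i ≤ n`. -/
inductive HeckeRel {n : ℕ} [NeZero n] {A : Type} [Ring A] [Algebra ℂ A]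
    (T : Fin n → A) (q : ℂ) : A → A → Prop
  | comm (i j : Fin n) (h : (i : ℕ) + 1 < j) : HeckeRel T q (T i * T j) (T j * T i)
  | braid (i j : Fin n) (hi : i ≠ 0) (hj : (j : ℕ) = i + 1) :
      HeckeRel T q (T i * T j * T i) (T j * T i * T j)
  | braid₄ (j : Fin n) (hj : (j : ℕ) = 1) :
      HeckeRel T q (T 0 * T j * T 0 * T j) (T j * T 0 * T j * T 0)
  | quad (i : Fin n) (hi : i ≠ 0) : HeckeRel T q ((T i - 1) * (T i + algebraMap ℂ A q)) 0

/-- The defining relations of the cyclotomic Hecke algebra: the relations `HeckeRel` together with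
`(T_1 - u_1) ⋯ (T_1 - u_r) = 0`. -/
inductive CycRel (n : ℕ) [NeZero n] {r : ℕ} (u : Fin r → ℂ) (q : ℂ) :
    FreeAlgebra ℂ (Fin n) → FreeAlgebra ℂ (Fin n) → Prop
  | hecke {a b : FreeAlgebra ℂ (Fin n)} (h : HeckeRel (FreeAlgebra.ι ℂ) q a b) : CycRel n u q a b
  | cyc : CycRel n u q (aeval (FreeAlgebra.ι ℂ (0 : Fin n)) (∏ j, (X - C (u j)))) 0

/-- The cyclotomic Hecke algebra `H_{r,1,n}(u_1, …, u_r, q)`. -/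
abbrev Cyc (n : ℕ) [NeZero n] {r : ℕ} (u : Fin r → ℂ) (q : ℂ) : Type :=
  RingQuot (CycRel n u q)

/-- The generators of the cyclotomic Hecke algebra; `Cyc.T n u q 0` is `T_1`. -/
def Cyc.T (n : ℕ) [NeZero n] {r : ℕ} (u : Fin r → ℂ) (q : ℂ) (i : Fin n) : Cyc n u q :=
  RingQuot.mkAlgHom ℂ (CycRel n u q) (FreeAlgebra.ι ℂ i)

/-- The defining relations of the affine Hecke algebra. The generator `some 0` is `X`, `none` is
its inverse, and `some i` for `i ≠ 0` are the remaining `T_i`. -/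
inductive AffRel (n : ℕ) [NeZero n] (q : ℂ) :
    FreeAlgebra ℂ (Option (Fin n)) → FreeAlgebra ℂ (Option (Fin n)) → Prop
  | hecke {a b : FreeAlgebra ℂ (Option (Fin n))}
      (h : HeckeRel (fun i : Fin n => FreeAlgebra.ι ℂ (some i)) q a b) : AffRel n q a b
  | mul_inv : AffRel n q (FreeAlgebra.ι ℂ (some 0) * FreeAlgebra.ι ℂ none) 1
  | inv_mul : AffRel n q (FreeAlgebra.ι ℂ none * FreeAlgebra.ι ℂ (some 0)) 1

/-- The affine Hecke algebra `H_{∞,1,n}(q)`. -/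
abbrev Aff (n : ℕ) [NeZero n] (q : ℂ) : Type := RingQuot (AffRel n q)

/-- The generators of the affine Hecke algebra: `Aff.T n q 0` is `X`, and `Aff.T n q i` for `i ≠ 0`
are the remaining `T_i`. -/
def Aff.T (n : ℕ) [NeZero n] (q : ℂ) (i : Fin n) : Aff n q :=
  RingQuot.mkAlgHom ℂ (AffRel n q) (FreeAlgebra.ι ℂ (some i))

/-- The generator `X⁻¹` of the affine Hecke algebra. -/
def Aff.Xinv (n : ℕ) [NeZero n] (q : ℂ) : Aff n q :=
  RingQuot.mkAlgHom ℂ (AffRel n q) (FreeAlgebra.ι ℂ none)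

/-- `H_{r,p,n}`: the subalgebra of the cyclotomic Hecke algebra generated by `T_1 ^ p`,
`T_1⁻¹ T_2 T_1` (present for `n ≥ 2`) and `T_i`, `2 ≤ i ≤ n`. By `Cyc.isUnit_T_zero` below, `T_1`
is a unit when all `u_j` are nonzero, and then `Ring.inverse` is the true inverse. -/
def cycSub (p n : ℕ) [NeZero n] {r : ℕ} (u : Fin r → ℂ) (q : ℂ) : Subalgebra ℂ (Cyc n u q) :=
  Algebra.adjoin ℂ
    ({Cyc.T n u q 0 ^ p} ∪
      {y | ∃ j : Fin n, (j : ℕ) = 1 ∧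
        y = Ring.inverse (Cyc.T n u q 0) * Cyc.T n u q j * Cyc.T n u q 0} ∪
      {y | ∃ i : Fin n, i ≠ 0 ∧ y = Cyc.T n u q i})

/-- `H_{∞,p,n}`: the subalgebra of the affine Hecke algebra generated by `X ^ p` and its inverse,
`X⁻¹ T_2 X` (present for `n ≥ 2`) and `T_i`, `2 ≤ i ≤ n`. -/
def affSub (p n : ℕ) [NeZero n] (q : ℂ) : Subalgebra ℂ (Aff n q) :=
  Algebra.adjoin ℂ
    ({Aff.T n q 0 ^ p, Aff.Xinv n q ^ p} ∪
      {y | ∃ j : Fin n, (j : ℕ) = 1 ∧ y = Aff.Xinv n q * Aff.T n q j * Aff.T n q 0} ∪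
      {y | ∃ i : Fin n, i ≠ 0 ∧ y = Aff.T n q i})

section Relations

theorem HeckeRel.map {n : ℕ} [NeZero n] {A B : Type} [Ring A] [Algebra ℂ A] [Ring B] [Algebra ℂ B]
    {T : Fin n → A} {q : ℂ} {a b : A} (h : HeckeRel T q a b) (f : A →ₐ[ℂ] B) :
    HeckeRel (fun i => f (T i)) q (f a) (f b) := by
  cases h with
  | comm i j h => simpa using HeckeRel.comm (T := fun i => f (T i)) (q := q) i j h
  | braid i j hi hj => simpa using HeckeRel.braid (T := fun i => f (T i)) (q := q) i j hi hj
  | braid₄ j hj => simpa using HeckeRel.braid₄ (T := fun i => f (T i)) (q := q) j hj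
  | quad i hi => simpa using HeckeRel.quad (T := fun i => f (T i)) (q := q) i hi

/-- If a family satisfies the relations, so does the family with the first member rescaled. -/
theorem HeckeRel.rescale {n : ℕ} [NeZero n] {A : Type} [Ring A] [Algebra ℂ A]
    {T S : Fin n → A} {q c : ℂ} (hT : ∀ a b, HeckeRel T q a b → a = b)
    (h0 : S 0 = c • T 0) (hS : ∀ i, i ≠ 0 → S i = T i) {a b : A} (h : HeckeRel S q a b) :
    a = b := by
  cases h with
  | comm i j h =>
    have hj : j ≠ 0 := by rintro rfl; simp at h
    rw [hS j hj]
    have := hT _ _ (HeckeRel.comm i j h)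
    by_cases hi : i = 0
    · subst hi
      rw [h0, smul_mul_assoc, mul_smul_comm, this]
    · rw [hS i hi, this]
  | braid i j hi hj =>
    have hj' : j ≠ 0 := by rintro rfl; simp at hj
    rw [hS i hi, hS j hj']
    exact hT _ _ (HeckeRel.braid i j hi hj)
  | braid₄ j hj =>
    have hj' : j ≠ 0 := by rintro rfl; simp at hj
    rw [h0, hS j hj']
    simp only [smul_mul_assoc, mul_smul_comm]
    rw [hT _ _ (HeckeRel.braid₄ j hj)]
  | quad i hi =>
    rw [hS i hi]
    exact hT _ _ (HeckeRel.quad i hi)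

theorem Cyc.heckeRel_eq {n : ℕ} [NeZero n] {r : ℕ} {u : Fin r → ℂ} {q : ℂ} (a b : Cyc n u q)
    (h : HeckeRel (Cyc.T n u q) q a b) : a = b := by
  have key : ∀ a b, HeckeRel (FreeAlgebra.ι ℂ) q a b →
      RingQuot.mkAlgHom ℂ (CycRel n u q) a = RingQuot.mkAlgHom ℂ (CycRel n u q) b :=
    fun a b h => RingQuot.mkAlgHom_rel ℂ (CycRel.hecke h)
  cases h with
  | comm i j h => simpa [Cyc.T] using key _ _ (HeckeRel.comm i j h)
  | braid i j hi hj => simpa [Cyc.T] using key _ _ (HeckeRel.braid i j hi hj)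
  | braid₄ j hj => simpa [Cyc.T] using key _ _ (HeckeRel.braid₄ j hj)
  | quad i hi => simpa [Cyc.T] using key _ _ (HeckeRel.quad i hi)

theorem Aff.heckeRel_eq {n : ℕ} [NeZero n] {q : ℂ} (a b : Aff n q)
    (h : HeckeRel (Aff.T n q) q a b) : a = b := by
  have key : ∀ a b, HeckeRel (fun i : Fin n => FreeAlgebra.ι ℂ (some i)) q a b →
      RingQuot.mkAlgHom ℂ (AffRel n q) a = RingQuot.mkAlgHom ℂ (AffRel n q) b :=
    fun a b h => RingQuot.mkAlgHom_rel ℂ (AffRel.hecke h)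
  cases h with
  | comm i j h => simpa [Aff.T] using key _ _ (HeckeRel.comm i j h)
  | braid i j hi hj => simpa [Aff.T] using key _ _ (HeckeRel.braid i j hi hj)
  | braid₄ j hj => simpa [Aff.T] using key _ _ (HeckeRel.braid₄ j hj)
  | quad i hi => simpa [Aff.T] using key _ _ (HeckeRel.quad i hi)

theorem Aff.T_mul_Xinv (n : ℕ) [NeZero n] (q : ℂ) : Aff.T n q 0 * Aff.Xinv n q = 1 := by
  simpa [Aff.T, Aff.Xinv] using RingQuot.mkAlgHom_rel ℂ (AffRel.mul_inv (n := n) (q := q))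

theorem Aff.Xinv_mul_T (n : ℕ) [NeZero n] (q : ℂ) : Aff.Xinv n q * Aff.T n q 0 = 1 := by
  simpa [Aff.T, Aff.Xinv] using RingQuot.mkAlgHom_rel ℂ (AffRel.inv_mul (n := n) (q := q))

theorem Cyc.aeval_T_zero (n : ℕ) [NeZero n] {r : ℕ} (u : Fin r → ℂ) (q : ℂ) :
    aeval (Cyc.T n u q 0) (∏ j, (X - C (u j))) = 0 := by
  have := RingQuot.mkAlgHom_rel ℂ (CycRel.cyc (n := n) (u := u) (q := q))
  rwa [map_zero, ← aeval_algHom_apply] at this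

theorem Cyc.isUnit_T_zero (n : ℕ) [NeZero n] {r : ℕ} (u : Fin r → ℂ) (q : ℂ)
    (hu : ∀ j, u j ≠ 0) : IsUnit (Cyc.T n u q 0) := by
  have h0 : IsCoprime (X : ℂ[X]) (∏ j, (X - C (u j))) := by
    refine IsCoprime.prod_right fun j _ => ?_
    simpa using isCoprime_X_sub_C_of_isUnit_sub (R := ℂ) (a := 0) (b := u j)
      (by simpa using hu j)
  obtain ⟨a, b, hab⟩ := h0
  have h := congrArg (aeval (Cyc.T n u q 0)) hab
  simp only [map_add, map_mul, Cyc.aeval_T_zero, mul_zero, add_zero, aeval_X, map_one] at h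
  have h' := congrArg (aeval (Cyc.T n u q 0)) ((mul_comm X a).trans (eq_sub_of_add_eq hab))
  simp only [map_sub, map_mul, Cyc.aeval_T_zero, mul_zero, sub_zero, aeval_X, map_one] at h'
  exact ⟨⟨_, _, h', h⟩, rfl⟩

end Relations

/-- The algebra homomorphism out of the affine Hecke algebra given by a family satisfying the
relations and an inverse `s` of its first member. -/
def Aff.lift {n : ℕ} [NeZero n] {q : ℂ} {A : Type} [Ring A] [Algebra ℂ A] (T : Fin n → A) (s : A)
    (hT : ∀ a b, HeckeRel T q a b → a = b) (h₁ : T 0 * s = 1) (h₂ : s * T 0 = 1) :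
    Aff n q →ₐ[ℂ] A :=
  RingQuot.liftAlgHom ℂ ⟨FreeAlgebra.lift ℂ (fun o : Option (Fin n) => o.elim s T), by
    intro a b h
    cases h with
    | hecke h => exact hT _ _ (by simpa using h.map (FreeAlgebra.lift ℂ fun o => o.elim s T))
    | mul_inv => simpa using h₁
    | inv_mul => simpa using h₂⟩

@[simp] theorem Aff.lift_T {n : ℕ} [NeZero n] {q : ℂ} {A : Type} [Ring A] [Algebra ℂ A]
    (T : Fin n → A) (s : A) (hT : ∀ a b, HeckeRel T q a b → a = b) (h₁ : T 0 * s = 1)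
    (h₂ : s * T 0 = 1) (i : Fin n) : Aff.lift T s hT h₁ h₂ (Aff.T n q i) = T i := by
  simp [Aff.lift, Aff.T]

@[simp] theorem Aff.lift_Xinv {n : ℕ} [NeZero n] {q : ℂ} {A : Type} [Ring A] [Algebra ℂ A]
    (T : Fin n → A) (s : A) (hT : ∀ a b, HeckeRel T q a b → a = b) (h₁ : T 0 * s = 1)
    (h₂ : s * T 0 = 1) : Aff.lift T s hT h₁ h₂ (Aff.Xinv n q) = s := by
  simp [Aff.lift, Aff.Xinv]

theorem Aff.hom_ext {n : ℕ} [NeZero n] {q : ℂ} {A : Type} [Ring A] [Algebra ℂ A]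
    {f g : Aff n q →ₐ[ℂ] A} (h : ∀ i, f (Aff.T n q i) = g (Aff.T n q i))
    (h' : f (Aff.Xinv n q) = g (Aff.Xinv n q)) : f = g := by
  apply RingQuot.ringQuot_ext'
  apply FreeAlgebra.hom_ext
  funext o
  cases o with
  | none => exact h'
  | some i => exact h i

/-- The endomorphism `X ↦ c X`, `T_i ↦ T_i` (`i ≥ 2`) of the affine Hecke algebra. -/
def Aff.scale (n : ℕ) [NeZero n] (q c : ℂ) (hc : c ≠ 0) : Aff n q →ₐ[ℂ] Aff n q :=
  Aff.lift (fun i => if i = 0 then c • Aff.T n q 0 else Aff.T n q i) (c⁻¹ • Aff.Xinv n q)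
    (fun _ _ h => HeckeRel.rescale (T := Aff.T n q) (c := c) Aff.heckeRel_eq (by simp)
      (fun i hi => by simp [hi]) h)
    (by simp [Aff.T_mul_Xinv, smul_smul, hc]) (by simp [Aff.Xinv_mul_T, smul_smul, hc])

theorem Aff.scale_comp (n : ℕ) [NeZero n] (q c d : ℂ) (hc : c ≠ 0) (hd : d ≠ 0) (hcd : c * d = 1) :
    (Aff.scale n q c hc).comp (Aff.scale n q d hd) = AlgHom.id ℂ _ := by
  have hdc : d * c = 1 := by rw [mul_comm, hcd]
  apply Aff.hom_ext
  · intro i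
    by_cases hi : i = 0
    · subst hi; simp [Aff.scale, smul_smul, hdc]
    · simp [Aff.scale, hi]
  · simp [Aff.scale, smul_smul, ← mul_inv, hdc]

/-- The automorphism `τ` of the affine Hecke algebra with `τ(X) = ξ X` and `τ(T_i) = T_i` for
`i ≥ 2`. -/
def affTau (n : ℕ) [NeZero n] (q ξ : ℂ) (hξ : ξ ≠ 0) : Aff n q ≃ₐ[ℂ] Aff n q :=
  AlgEquiv.ofAlgHom (Aff.scale n q ξ hξ) (Aff.scale n q ξ⁻¹ (inv_ne_zero hξ))
    (Aff.scale_comp n q _ _ _ _ (mul_inv_cancel₀ hξ))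
    (Aff.scale_comp n q _ _ _ _ (inv_mul_cancel₀ hξ))

theorem affTau_X (n : ℕ) [NeZero n] (q ξ : ℂ) (hξ : ξ ≠ 0) :
    affTau n q ξ hξ (Aff.T n q 0) = ξ • Aff.T n q 0 := by
  simp [affTau, Aff.scale]

theorem affTau_T (n : ℕ) [NeZero n] (q ξ : ℂ) (hξ : ξ ≠ 0) (i : Fin n) (hi : i ≠ 0) :
    affTau n q ξ hξ (Aff.T n q i) = Aff.T n q i := by
  simp [affTau, Aff.scale, hi]

/-- The quotient map `φ` from the affine to the cyclotomic Hecke algebra, `X ↦ T_1` and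
`T_i ↦ T_i` for `i ≥ 2`. -/
def quotMap (n : ℕ) [NeZero n] {r : ℕ} (u : Fin r → ℂ) (q : ℂ) (hu : ∀ j, u j ≠ 0) :
    Aff n q →ₐ[ℂ] Cyc n u q :=
  Aff.lift (Cyc.T n u q) (Ring.inverse (Cyc.T n u q 0)) Cyc.heckeRel_eq
    (Ring.mul_inverse_cancel _ (Cyc.isUnit_T_zero n u q hu))
    (Ring.inverse_mul_cancel _ (Cyc.isUnit_T_zero n u q hu))

theorem quotMap_T (n : ℕ) [NeZero n] {r : ℕ} (u : Fin r → ℂ) (q : ℂ) (hu : ∀ j, u j ≠ 0)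
    (i : Fin n) : quotMap n u q hu (Aff.T n q i) = Cyc.T n u q i := by
  simp [quotMap]

theorem quotMap_surjective (n : ℕ) [NeZero n] {r : ℕ} (u : Fin r → ℂ) (q : ℂ)
    (hu : ∀ j, u j ≠ 0) : Function.Surjective (quotMap n u q hu) := by
  intro y
  obtain ⟨x, rfl⟩ := RingQuot.mkAlgHom_surjective ℂ (CycRel n u q) y
  refine ⟨FreeAlgebra.lift ℂ (Aff.T n q) x, ?_⟩
  have : (quotMap n u q hu).comp (FreeAlgebra.lift ℂ (Aff.T n q)) =
      RingQuot.mkAlgHom ℂ (CycRel n u q) := by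
    apply FreeAlgebra.hom_ext
    funext i
    simp [quotMap_T, Cyc.T]
  exact DFunLike.congr_fun this x

end CycloHecke

end

noncomputable section

namespace CycloHecke

/-! For fixed `l` the numbers `ξ ^ k * v l` are the roots of `t ^ p - v l ^ p`, so the cyclotomic
relation involves only `T_1 ^ p`. The other relations survive rescaling `T_1`, and hence `τ` exists.

Let `S` be `H_{r,p,n}`. That `τ` fixes `S` is checked on generators. For the converse, `T_1`
normalizes `S` (`T_zero_conj_cycSub`), so the whole algebra is the sum of the spaces `S T_1 ^ k`, on
which `τ` acts by `ξ ^ k`. Summing over the powers of `τ` kills the terms with `p ∤ k`, and the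
terms with `p ∣ k` lie in `S`. On a fixed element this sum is multiplication by `p`, so the element
is in `S` (`mem_of_fixed`). The sum of the `S T_1 ^ k` need not be direct, so no basis of the Hecke
algebra is needed. The one delicate point of the normalization is `T_1 T_2 T_1⁻¹ ∈ S`
(`Cyc.T_mul_conj_mem`), where `q ≠ 0` enters.

The orders are exactly `p` because `T_1` and `X` are nonzero, which a one-dimensional representation
shows. -/

/-! ### Fixed points of an automorphism that scales one element. -/

/-- If `T_1 h ∈ S T_1` for all `h ∈ S`, then the left module generated over `S` by the powers of
`T_1` is the algebra generated by `S` and `T_1`. -/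
theorem span_mul_pow_eq_top {A : Type*} [Ring A] [Algebra ℂ A] {S : Subalgebra ℂ A} {t : A}
    (hconj : ∀ h ∈ S, ∃ h' ∈ S, t * h = h' * t)
    (htop : Algebra.adjoin ℂ (insert t (S : Set A)) = ⊤) :
    Submodule.span ℂ {x : A | ∃ h ∈ S, ∃ k : ℕ, x = h * t ^ k} = ⊤ := by
  set M := Submodule.span ℂ {x : A | ∃ h ∈ S, ∃ k : ℕ, x = h * t ^ k} with hM
  -- Stability under `t` comes from `t * (h * t ^ k) = h' * t ^ (k + 1)`. Then `M` is a left ideal,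
  -- and it contains `1`.
  have hgen : ∀ a ∈ insert t (S : Set A), ∀ x ∈ M, a * x ∈ M := by
    intro a ha x hx
    induction hx using Submodule.span_induction with
    | mem x hx =>
      obtain ⟨h, hh, k, rfl⟩ := hx
      apply Submodule.subset_span
      rcases ha with rfl | ha
      · obtain ⟨h', hh', e⟩ := hconj h hh
        exact ⟨h', hh', k + 1, by rw [← mul_assoc, e, mul_assoc, pow_succ']⟩
      · exact ⟨a * h, S.mul_mem ha hh, k, (mul_assoc _ _ _).symm⟩
    | zero => simp
    | add x y _ _ hx hy => rw [mul_add]; exact M.add_mem hx hy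
    | smul c x _ hx => rw [mul_smul_comm]; exact M.smul_mem c hx
  have hall : ∀ a : A, ∀ x ∈ M, a * x ∈ M := by
    intro a
    have ha : a ∈ Algebra.adjoin ℂ (insert t (S : Set A)) := htop ▸ Algebra.mem_top
    induction ha using Algebra.adjoin_induction with
    | mem a ha => exact hgen a ha
    | algebraMap c =>
      intro x hx
      rw [← Algebra.smul_def]
      exact M.smul_mem c hx
    | add a b _ _ ha hb =>
      intro x hx
      rw [add_mul]
      exact M.add_mem (ha x hx) (hb x hx)
    | mul a b _ _ ha hb =>
      intro x hx
      rw [mul_assoc]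
      exact ha _ (hb x hx)
  rw [eq_top_iff]
  intro x _
  have h1 : (1 : A) ∈ M := Submodule.subset_span ⟨1, S.one_mem, 0, by simp⟩
  simpa using hall x 1 h1

theorem pow_apply_eq_self {A : Type*} [Ring A] [Algebra ℂ A] (τ : A ≃ₐ[ℂ] A) {x : A}
    (h : τ x = x) (j : ℕ) : (τ ^ j) x = x :=
  (MulAction.stabilizer (A ≃ₐ[ℂ] A) x).pow_mem (x := τ) h j

theorem pow_apply_eq_smul {A : Type*} [Ring A] [Algebra ℂ A] (τ : A ≃ₐ[ℂ] A) {t : A} {ξ : ℂ}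
    (h : τ t = ξ • t) (j : ℕ) : (τ ^ j) t = ξ ^ j • t := by
  induction j with
  | zero => simp
  | succ j ih => rw [pow_succ, AlgEquiv.mul_apply, h, map_smul, ih, smul_smul, pow_succ']

/-- Fixed points of an automorphism scaling `t` by a primitive root of unity and fixing a
subalgebra normalized by `t`. -/
theorem mem_of_fixed {A : Type*} [Ring A] [Algebra ℂ A] {S : Subalgebra ℂ A} {t : A}
    {p : ℕ} (hp : 0 < p) {ξ : ℂ} (hξ : IsPrimitiveRoot ξ p) (τ : A ≃ₐ[ℂ] A)
    (hτt : τ t = ξ • t) (hτS : ∀ h ∈ S, τ h = h) (htp : t ^ p ∈ S)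
    (hconj : ∀ h ∈ S, ∃ h' ∈ S, t * h = h' * t)
    (htop : Algebra.adjoin ℂ (insert t (S : Set A)) = ⊤) {x : A} (hx : τ x = x) : x ∈ S := by
  have hpowt := pow_apply_eq_smul τ hτt
  -- `E` is `p` times the averaging projection. It acts on `h * t ^ k` by the geometric sum of `ξ ^
  -- k`, which vanishes unless `p ∣ k`.
  let E : A →ₗ[ℂ] A := ∑ j ∈ Finset.range p, (τ ^ j).toLinearMap
  have hE : ∀ y, E y = ∑ j ∈ Finset.range p, (τ ^ j) y := fun y => by
    simp [E, LinearMap.sum_apply]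
  have hle : (⊤ : Submodule ℂ A) ≤ (Subalgebra.toSubmodule S).comap E := by
    rw [← span_mul_pow_eq_top hconj htop, Submodule.span_le]
    rintro _ ⟨h, hh, k, rfl⟩
    have key : E (h * t ^ k) = (∑ j ∈ Finset.range p, (ξ ^ k) ^ j) • (h * t ^ k) := by
      rw [hE, Finset.sum_smul]
      refine Finset.sum_congr rfl fun j _ => ?_
      rw [map_mul, map_pow, pow_apply_eq_self τ (hτS h hh), hpowt, _root_.smul_pow, mul_smul_comm, pow_right_comm]
    simp only [SetLike.mem_coe, Submodule.mem_comap, Subalgebra.mem_toSubmodule]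
    rw [key]
    by_cases hk : p ∣ k
    · obtain ⟨m, rfl⟩ := hk
      rw [pow_mul t]
      exact S.smul_mem (S.mul_mem hh (S.pow_mem htp m)) _
    · have h1 : ξ ^ k ≠ 1 := fun e => hk ((hξ.pow_eq_one_iff_dvd k).1 e)
      have h2 : ∑ j ∈ Finset.range p, (ξ ^ k) ^ j = 0 := by
        rw [geom_sum_eq h1, ← pow_mul, mul_comm k p, pow_mul, hξ.pow_eq_one]
        simp
      rw [h2, zero_smul]
      exact S.zero_mem
  have hxE : E x = (p : ℂ) • x := by
    rw [hE, Finset.sum_congr rfl fun j _ => pow_apply_eq_self τ hx j]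
    simp [Nat.cast_smul_eq_nsmul]
  have hmem : E x ∈ S := hle (Submodule.mem_top (x := x))
  rw [hxE] at hmem
  have hp' : (p : ℂ) ≠ 0 := by exact_mod_cast hp.ne'
  simpa [smul_smul, hp'] using S.smul_mem hmem (p : ℂ)⁻¹

/-! ### Order of the automorphism and the action of `ℤ/pℤ`. -/

/-- `τ ^ j` scales `t ≠ 0` by `ξ ^ j`, so `τ ^ j = 1` forces `ξ ^ j = 1`. The hypothesis `h1` gives
the converse; it holds when the other generators are fixed by `τ`. -/
theorem orderOf_eq_of_scale {A : Type*} [Ring A] [Algebra ℂ A] {p : ℕ} {ξ : ℂ}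
    (hξ : IsPrimitiveRoot ξ p) (τ : A ≃ₐ[ℂ] A) {t : A} (ht : t ≠ 0) (hτt : τ t = ξ • t)
    (h1 : ∀ σ : A ≃ₐ[ℂ] A, (∃ j : ℕ, σ = τ ^ j) → σ t = t → σ = 1) : orderOf τ = p := by
  have hpowt := pow_apply_eq_smul τ hτt
  rw [hξ.eq_orderOf]
  refine orderOf_eq_orderOf_iff.2 fun j => ⟨fun h => ?_, fun h => ?_⟩
  · have := hpowt j
    rw [h, AlgEquiv.one_apply] at this
    have h0 : (ξ ^ j - 1) • t = 0 := by rw [sub_smul, one_smul, ← this, sub_self]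
    exact sub_eq_zero.1 ((smul_eq_zero.1 h0).resolve_right ht)
  · exact h1 _ ⟨j, rfl⟩ (by rw [hpowt, h, one_smul])

/-- An automorphism of order `p` is the image of `1` under a faithful action of `ℤ/pℤ`. -/
theorem exists_zmod_action {A : Type*} [Ring A] [Algebra ℂ A] {p : ℕ} (τ : A ≃ₐ[ℂ] A)
    (hτ : orderOf τ = p) :
    ∃ ρ : Multiplicative (ZMod p) →* (A ≃ₐ[ℂ] A), Function.Injective ρ ∧
      ρ (Multiplicative.ofAdd 1) = τ ∧ ∀ x, (∀ g, ρ g x = x) ↔ τ x = x := by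
  -- The map `z ↦ τ ^ z`, written additively so that `ZMod.lift` can factor it through `ℤ/pℤ`.
  let f : ℤ →+ Additive (A ≃ₐ[ℂ] A) := zmultiplesHom _ (Additive.ofMul τ)
  have hf : f p = 0 := by
    change ((p : ℕ) : ℤ) • Additive.ofMul τ = 0
    rw [natCast_zsmul, ← ofMul_pow, ← hτ, pow_orderOf_eq_one, ofMul_one]
  let ρ : Multiplicative (ZMod p) →* (A ≃ₐ[ℂ] A) :=
    AddMonoidHom.toMultiplicativeLeft (ZMod.lift p ⟨f, hf⟩)
  have hρ : ∀ z : ℤ, ρ (Multiplicative.ofAdd (z : ZMod p)) = τ ^ z := by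
    intro z
    change Additive.toMul (ZMod.lift p ⟨f, hf⟩ (z : ZMod p)) = τ ^ z
    rw [ZMod.lift_coe]
    rfl
  have hρ1 : ρ (Multiplicative.ofAdd 1) = τ := by simpa using hρ 1
  refine ⟨ρ, ?_, hρ1, fun x => ⟨fun h => ?_, fun h g => ?_⟩⟩
  · rw [injective_iff_map_eq_one]
    intro g hg
    obtain ⟨z, hz⟩ := ZMod.intCast_surjective (Multiplicative.toAdd g)
    have hz' : g = Multiplicative.ofAdd (z : ZMod p) := by rw [hz]; rfl
    rw [hz', hρ, ← orderOf_dvd_iff_zpow_eq_one, hτ] at hg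
    rw [hz', (ZMod.intCast_zmod_eq_zero_iff_dvd z p).2 hg, ofAdd_zero]
  · simpa [hρ1] using h (Multiplicative.ofAdd 1)
  · obtain ⟨z, hz⟩ := ZMod.intCast_surjective (Multiplicative.toAdd g)
    have hz' : g = Multiplicative.ofAdd (z : ZMod p) := by rw [hz]; rfl
    rw [hz', hρ]
    exact (MulAction.stabilizer (A ≃ₐ[ℂ] A) x).zpow_mem (x := τ) h z

/-! ### The cyclotomic polynomial. -/

theorem prod_X_sub_C_eq {r p : ℕ} (hp0 : 0 < p) (hp : p ∣ r) {ξ : ℂ}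
    (hξ : IsPrimitiveRoot ξ p) (v : Fin (r / p) → ℂ) (u : Fin r → ℂ)
    (huv : ∀ (j : Fin r) (l : Fin (r / p)) (k : Fin p),
      (j : ℕ) = (l : ℕ) * p + (k : ℕ) → u j = ξ ^ (k : ℕ) * v l) :
    ∏ j, (X - C (u j)) = ∏ l, (X ^ p - C (v l ^ p)) := by
  -- The index `j` is replaced by the pair `(l, k)` with `j = l * p + k`; each inner product over
  -- `k` is then one factor `X ^ p - C (v l ^ p)`.
  rw [← Equiv.prod_comp (finProdFinEquiv.trans (finCongr (Nat.div_mul_cancel hp))),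
    Fintype.prod_prod_type]
  refine Finset.prod_congr rfl fun l _ => ?_
  rw [X_pow_sub_C_eq_prod hξ hp0 rfl, ← Fin.prod_univ_eq_prod_range (fun i => X - C (ξ ^ i * v l))]
  refine Finset.prod_congr rfl fun k _ => ?_
  rw [huv _ l k]
  simp [finProdFinEquiv, add_comm, mul_comm]

/-! ### The cyclotomic algebra and its automorphism `τ`. -/

section Cyclotomic

variable {n : ℕ} [NeZero n] {r : ℕ} {u : Fin r → ℂ} {q : ℂ}

/-- The algebra homomorphism out of the cyclotomic Hecke algebra given by a family satisfying the
relations. -/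
def Cyc.lift {A : Type} [Ring A] [Algebra ℂ A] (T : Fin n → A)
    (hT : ∀ a b, HeckeRel T q a b → a = b) (h0 : aeval (T 0) (∏ j, (X - C (u j))) = 0) :
    Cyc n u q →ₐ[ℂ] A :=
  RingQuot.liftAlgHom ℂ ⟨FreeAlgebra.lift ℂ T, by
    intro a b h
    cases h with
    | hecke h => exact hT _ _ (by simpa using h.map (FreeAlgebra.lift ℂ T))
    | cyc => rw [map_zero, ← aeval_algHom_apply, FreeAlgebra.lift_ι_apply, h0]⟩

@[simp] theorem Cyc.lift_T {A : Type} [Ring A] [Algebra ℂ A] (T : Fin n → A)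
    (hT : ∀ a b, HeckeRel T q a b → a = b) (h0 : aeval (T 0) (∏ j, (X - C (u j))) = 0)
    (i : Fin n) : Cyc.lift T hT h0 (Cyc.T n u q i) = T i := by
  simp [Cyc.lift, Cyc.T]

theorem Cyc.hom_ext {A : Type} [Ring A] [Algebra ℂ A] {f g : Cyc n u q →ₐ[ℂ] A}
    (h : ∀ i, f (Cyc.T n u q i) = g (Cyc.T n u q i)) : f = g := by
  apply RingQuot.ringQuot_ext'
  apply FreeAlgebra.hom_ext
  funext i
  exact h i

/-- The one-dimensional representation `T_1 ↦ u_1`, `T_i ↦ 1` shows that the algebra is nonzero. -/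
theorem Cyc.nontrivial (hr : 0 < r) : Nontrivial (Cyc n u q) := by
  let T : Fin n → ℂ := fun i => if i = 0 then u ⟨0, hr⟩ else 1
  have hT : ∀ i, i ≠ 0 → T i = 1 := fun i hi => if_neg hi
  let f : Cyc n u q →ₐ[ℂ] ℂ := Cyc.lift T (by
      intro a b h
      cases h with
      | comm i j h => exact mul_comm _ _
      | braid i j hi hj =>
        have hj' : j ≠ 0 := by rintro rfl; simp at hj
        rw [hT i hi, hT j hj']
      | braid₄ j hj => ring
      | quad i hi => rw [hT i hi, sub_self, zero_mul]) (by
      rw [map_prod]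
      exact Finset.prod_eq_zero (Finset.mem_univ ⟨0, hr⟩) (by simp [T]))
  exact f.toRingHom.domain_nontrivial

theorem Cyc.adjoin_T : Algebra.adjoin ℂ (Set.range (Cyc.T n u q)) = ⊤ := by
  rw [eq_top_iff]
  intro y _
  obtain ⟨x, rfl⟩ := RingQuot.mkAlgHom_surjective ℂ (CycRel n u q) y
  have hx : x ∈ Algebra.adjoin ℂ (Set.range (FreeAlgebra.ι ℂ : Fin n → _)) := by
    rw [FreeAlgebra.adjoin_range_ι]; exact Algebra.mem_top
  have h : RingQuot.mkAlgHom ℂ (CycRel n u q) x ∈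
      (Algebra.adjoin ℂ (Set.range (FreeAlgebra.ι ℂ : Fin n → _))).map
        (RingQuot.mkAlgHom ℂ (CycRel n u q)) := ⟨x, hx, rfl⟩
  rwa [AlgHom.map_adjoin, ← Set.range_comp] at h

/-- The endomorphism `T_1 ↦ c T_1`, `T_i ↦ T_i` (`i ≥ 2`) of the cyclotomic Hecke algebra. -/
def Cyc.scale (c : ℂ) (hc : aeval (c • Cyc.T n u q 0) (∏ j, (X - C (u j))) = 0) :
    Cyc n u q →ₐ[ℂ] Cyc n u q :=
  Cyc.lift (fun i => if i = 0 then c • Cyc.T n u q 0 else Cyc.T n u q i)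
    (fun _ _ h => HeckeRel.rescale (T := Cyc.T n u q) (c := c) Cyc.heckeRel_eq (by simp)
      (fun i hi => by simp [hi]) h) (by simpa using hc)

theorem Cyc.scale_T_zero (c : ℂ) (hc : aeval (c • Cyc.T n u q 0) (∏ j, (X - C (u j))) = 0) :
    Cyc.scale c hc (Cyc.T n u q 0) = c • Cyc.T n u q 0 := by
  simp [Cyc.scale]

theorem Cyc.scale_T (c : ℂ) (hc : aeval (c • Cyc.T n u q 0) (∏ j, (X - C (u j))) = 0)
    (i : Fin n) (hi : i ≠ 0) : Cyc.scale c hc (Cyc.T n u q i) = Cyc.T n u q i := by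
  simp [Cyc.scale, hi]

theorem Cyc.scale_comp (c d : ℂ) (hc : aeval (c • Cyc.T n u q 0) (∏ j, (X - C (u j))) = 0)
    (hd : aeval (d • Cyc.T n u q 0) (∏ j, (X - C (u j))) = 0) (hcd : d * c = 1) :
    (Cyc.scale c hc).comp (Cyc.scale d hd) = AlgHom.id ℂ _ := by
  apply Cyc.hom_ext
  intro i
  by_cases hi : i = 0
  · subst hi; simp [Cyc.scale_T_zero, smul_smul, hcd]
  · simp [Cyc.scale_T, hi]

/-- The polynomial has the form `g(t ^ p)`, so its value at `c • T_1` depends on `c` only through `c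
^ p`. -/
theorem Cyc.aeval_smul_T_zero {p d : ℕ} {v : Fin d → ℂ}
    (h : ∏ j, (X - C (u j)) = ∏ l, (X ^ p - C (v l ^ p))) {c : ℂ} (hc : c ^ p = 1) :
    aeval (c • Cyc.T n u q 0) (∏ j, (X - C (u j))) = 0 := by
  have h0 := Cyc.aeval_T_zero n u q
  have hexp : ∏ j, (X - C (u j)) = expand ℂ p (∏ l, (X - C (v l ^ p))) := by
    rw [h, map_prod]
    simp only [map_sub, expand_X, expand_C]
  rw [hexp, expand_aeval] at h0 ⊢
  rw [_root_.smul_pow, hc, one_smul, h0]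

/-- The automorphism `τ` of the cyclotomic Hecke algebra with `τ(T_1) = ξ T_1` and `τ(T_i) = T_i`
for `i ≥ 2`. -/
theorem Cyc.exists_tau {p d : ℕ} {v : Fin d → ℂ}
    (h : ∏ j, (X - C (u j)) = ∏ l, (X ^ p - C (v l ^ p))) {ξ : ℂ} (hξ : ξ ^ p = 1)
    (hξ0 : ξ ≠ 0) :
    ∃ τ : Cyc n u q ≃ₐ[ℂ] Cyc n u q, τ (Cyc.T n u q 0) = ξ • Cyc.T n u q 0 ∧
      ∀ i : Fin n, i ≠ 0 → τ (Cyc.T n u q i) = Cyc.T n u q i := by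
  have h1 := Cyc.aeval_smul_T_zero (n := n) (q := q) h hξ
  have h2 := Cyc.aeval_smul_T_zero (n := n) (q := q) h (c := ξ⁻¹) (by rw [inv_pow, hξ, inv_one])
  exact ⟨AlgEquiv.ofAlgHom (Cyc.scale ξ h1) (Cyc.scale ξ⁻¹ h2)
    (Cyc.scale_comp _ _ _ _ (inv_mul_cancel₀ hξ0)) (Cyc.scale_comp _ _ _ _ (mul_inv_cancel₀ hξ0)),
    Cyc.scale_T_zero ξ h1, Cyc.scale_T ξ h1⟩

/-! ### `H_{r,p,n}` is normalized by `T_1` and is the fixed algebra. -/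

/-- With `t = T_1` and `b = T_2`, the length-four braid relation multiplied by `t⁻¹` on both sides
reads `b (t b t⁻¹) = (t⁻¹ b t) b`. The right side is in `S`, and `b` has its inverse in `S` since `q
≠ 0`. -/
theorem Cyc.T_mul_conj_mem {S : Subalgebra ℂ (Cyc n u q)} (hq : q ≠ 0) {s : Cyc n u q}
    (hs : Cyc.T n u q 0 * s = 1) (hs' : s * Cyc.T n u q 0 = 1) {j : Fin n} (hj : (j : ℕ) = 1)
    (h2 : Cyc.T n u q j ∈ S) (h3 : s * Cyc.T n u q j * Cyc.T n u q 0 ∈ S) :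
    Cyc.T n u q 0 * Cyc.T n u q j * s ∈ S := by
  have hj0 : j ≠ 0 := by rintro rfl; simp at hj
  have hquad := Cyc.heckeRel_eq _ _ (HeckeRel.quad (T := Cyc.T n u q) (q := q) j hj0)
  have hbraid := Cyc.heckeRel_eq _ _ (HeckeRel.braid₄ (T := Cyc.T n u q) (q := q) j hj)
  set t := Cyc.T n u q 0
  set b := Cyc.T n u q j
  -- The quadratic relation expands to `(b + (q - 1)) b = q`.
  have hinv : (q⁻¹ • (b + algebraMap ℂ _ (q - 1))) * b = 1 := by
    have hc : (b + algebraMap ℂ _ (q - 1)) * b = algebraMap ℂ _ q := by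
      have hcomm := Algebra.commutes q b
      rw [map_sub, map_one]
      rw [sub_mul, one_mul, mul_add] at hquad
      rw [add_mul, sub_mul, one_mul, hcomm, ← sub_eq_zero, ← hquad]
      abel
    rw [smul_mul_assoc, hc, Algebra.algebraMap_eq_smul_one, smul_smul, inv_mul_cancel₀ hq, one_smul]
  have hkey : b * (t * b * s) = s * b * t * b := by
    calc b * (t * b * s) = s * t * (b * t * b * s) := by rw [hs', one_mul]; simp only [mul_assoc]
      _ = s * (t * b * t * b) * s := by simp only [mul_assoc]
      _ = s * b * t * b * (t * s) := by rw [hbraid]; simp only [mul_assoc]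
      _ = s * b * t * b := by rw [hs, mul_one]
  have : t * b * s = (q⁻¹ • (b + algebraMap ℂ _ (q - 1))) * (s * b * t * b) := by
    rw [← hkey, ← mul_assoc, hinv, one_mul]
  rw [this]
  exact S.mul_mem (S.smul_mem (S.add_mem h2 (S.algebraMap_mem _)) _) (S.mul_mem h3 h2)

theorem T_mem_cycSub (p : ℕ) {i : Fin n} (hi : i ≠ 0) : Cyc.T n u q i ∈ cycSub p n u q :=
  Algebra.subset_adjoin (Or.inr ⟨i, hi, rfl⟩)

theorem T_zero_pow_mem_cycSub (p : ℕ) : Cyc.T n u q 0 ^ p ∈ cycSub p n u q :=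
  Algebra.subset_adjoin (Or.inl (Or.inl rfl))

theorem conj_T_mem_cycSub (p : ℕ) {j : Fin n} (hj : (j : ℕ) = 1) :
    Ring.inverse (Cyc.T n u q 0) * Cyc.T n u q j * Cyc.T n u q 0 ∈ cycSub p n u q :=
  Algebra.subset_adjoin (Or.inl (Or.inr ⟨j, hj, rfl⟩))

/-- `T_1` normalizes `H_{r,p,n}`. -/
theorem T_zero_conj_cycSub (p : ℕ) (hq : q ≠ 0) (hu : ∀ j, u j ≠ 0) :
    ∀ h ∈ cycSub p n u q, ∃ h' ∈ cycSub p n u q, Cyc.T n u q 0 * h = h' * Cyc.T n u q 0 := by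
  have hs := Ring.mul_inverse_cancel _ (Cyc.isUnit_T_zero n u q hu)
  have hs' := Ring.inverse_mul_cancel _ (Cyc.isUnit_T_zero n u q hu)
  intro h hh
  induction hh using Algebra.adjoin_induction with
  | mem x hx =>
    rcases hx with (rfl | ⟨j, hj, rfl⟩) | ⟨i, hi, rfl⟩
    · exact ⟨_, T_zero_pow_mem_cycSub p, (Commute.self_pow _ _).eq⟩
    · have hj0 : j ≠ 0 := by rintro rfl; simp at hj
      exact ⟨_, T_mem_cycSub p hj0, by rw [← mul_assoc, ← mul_assoc, hs, one_mul]⟩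
    -- Index `1` is `T_2`, the one case that needs the braid relation; every later `T_i` commutes
    -- with `T_1`.
    · by_cases h1 : (i : ℕ) = 1
      · exact ⟨_, Cyc.T_mul_conj_mem hq hs hs' h1 (T_mem_cycSub p hi) (conj_T_mem_cycSub p h1),
          by rw [mul_assoc _ (Ring.inverse _), hs', mul_one]⟩
      · have hi' : (i : ℕ) ≠ 0 := fun e => hi (Fin.ext (by simpa using e))
        refine ⟨_, T_mem_cycSub p hi, Cyc.heckeRel_eq _ _ (HeckeRel.comm 0 i ?_)⟩
        rw [Fin.val_zero]
        omega
  | algebraMap c => exact ⟨_, Subalgebra.algebraMap_mem _ c, (Algebra.commutes c _).symm⟩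
  | add a b _ _ ha hb =>
    obtain ⟨a', ha', ea⟩ := ha
    obtain ⟨b', hb', eb⟩ := hb
    exact ⟨_, Subalgebra.add_mem _ ha' hb', by rw [mul_add, add_mul, ea, eb]⟩
  | mul a b _ _ ha hb =>
    obtain ⟨a', ha', ea⟩ := ha
    obtain ⟨b', hb', eb⟩ := hb
    exact ⟨_, Subalgebra.mul_mem _ ha' hb', by rw [← mul_assoc, ea, mul_assoc, eb, mul_assoc]⟩

/-- By uniqueness of inverses. It shows that `T_1⁻¹ T_2 T_1` and `T_1 ^ (-p)` are fixed by `τ`, and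
settles the generator `X⁻¹` in the commuting square. -/
theorem map_ringInverse_T_zero (hu : ∀ j, u j ≠ 0) {c : ℂ} (hc : c ≠ 0)
    (σ : Cyc n u q →ₐ[ℂ] Cyc n u q) (hσ : σ (Cyc.T n u q 0) = c • Cyc.T n u q 0) :
    σ (Ring.inverse (Cyc.T n u q 0)) = c⁻¹ • Ring.inverse (Cyc.T n u q 0) := by
  have hs := Ring.mul_inverse_cancel _ (Cyc.isUnit_T_zero n u q hu)
  have hs' := Ring.inverse_mul_cancel _ (Cyc.isUnit_T_zero n u q hu)
  refine left_inv_eq_right_inv (a := σ (Cyc.T n u q 0)) ?_ ?_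
  · rw [← map_mul, hs', map_one]
  · rw [hσ, smul_mul_smul_comm, hs, mul_inv_cancel₀ hc, one_smul]

/-- `H_{r,p,n}` is the fixed point algebra of `τ`. -/
theorem mem_cycSub_iff {p : ℕ} (hp : 0 < p) {ξ : ℂ} (hξ : IsPrimitiveRoot ξ p) (hq : q ≠ 0)
    (hu : ∀ j, u j ≠ 0) (τ : Cyc n u q ≃ₐ[ℂ] Cyc n u q)
    (hτ0 : τ (Cyc.T n u q 0) = ξ • Cyc.T n u q 0)
    (hτ : ∀ i : Fin n, i ≠ 0 → τ (Cyc.T n u q i) = Cyc.T n u q i) (x : Cyc n u q) :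
    x ∈ cycSub p n u q ↔ τ x = x := by
  have hξ0 : ξ ≠ 0 := hξ.ne_zero hp.ne'
  have hfix : ∀ x ∈ cycSub p n u q, τ x = x := by
    intro x hx
    induction hx using Algebra.adjoin_induction with
    | mem x hx =>
      rcases hx with (rfl | ⟨j, hj, rfl⟩) | ⟨i, hi, rfl⟩
      · rw [map_pow, hτ0, _root_.smul_pow, hξ.pow_eq_one, one_smul]
      · have hj0 : j ≠ 0 := by rintro rfl; simp at hj
        have hinv : τ (Ring.inverse (Cyc.T n u q 0)) = ξ⁻¹ • Ring.inverse (Cyc.T n u q 0) :=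
          map_ringInverse_T_zero hu hξ0 τ.toAlgHom hτ0
        rw [map_mul, map_mul, hinv, hτ j hj0, hτ0, smul_mul_assoc, smul_mul_smul_comm,
          inv_mul_cancel₀ hξ0, one_smul]
      · exact hτ i hi
    | algebraMap c => exact τ.commutes c
    | add a b _ _ ha hb => rw [map_add, ha, hb]
    | mul a b _ _ ha hb => rw [map_mul, ha, hb]
  refine ⟨hfix x, mem_of_fixed hp hξ τ hτ0 hfix (T_zero_pow_mem_cycSub p)
    (T_zero_conj_cycSub p hq hu) ?_⟩
  rw [eq_top_iff, ← Cyc.adjoin_T]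
  refine Algebra.adjoin_mono ?_
  rintro _ ⟨i, rfl⟩
  by_cases hi : i = 0
  · exact Or.inl (by rw [hi])
  · exact Or.inr (T_mem_cycSub p hi)

/-! ### The quotient map restricted to `H_{∞,p,n}`, and rigidity of automorphisms. -/

theorem quotMap_Xinv (hu : ∀ j, u j ≠ 0) :
    quotMap n u q hu (Aff.Xinv n q) = Ring.inverse (Cyc.T n u q 0) := by
  simp [quotMap]

/-- The quotient map sends `H_{∞,p,n}` onto `H_{r,p,n}` once the latter contains `T_1 ^ (-p)`. -/
theorem map_affSub {p : ℕ} (hu : ∀ j, u j ≠ 0)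
    (hinv : Ring.inverse (Cyc.T n u q 0) ^ p ∈ cycSub p n u q) :
    (affSub p n q).map (quotMap n u q hu) = cycSub p n u q := by
  apply le_antisymm
  · rw [affSub, AlgHom.map_adjoin, Algebra.adjoin_le_iff]
    rintro _ ⟨x, ((rfl | rfl) | ⟨j, hj, rfl⟩) | ⟨i, hi, rfl⟩, rfl⟩
    · simpa only [map_pow, SetLike.mem_coe, quotMap_T] using T_zero_pow_mem_cycSub p
    · simpa only [map_pow, SetLike.mem_coe, quotMap_Xinv] using hinv
    · simpa only [map_mul, SetLike.mem_coe, quotMap_T, quotMap_Xinv] using conj_T_mem_cycSub p hj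
    · simpa only [SetLike.mem_coe, quotMap_T] using T_mem_cycSub p hi
  · rw [affSub, AlgHom.map_adjoin, cycSub]
    refine Algebra.adjoin_mono ?_
    rintro _ ((rfl | ⟨j, hj, rfl⟩) | ⟨i, hi, rfl⟩)
    · exact ⟨_, Or.inl (Or.inl (Or.inl rfl)), by rw [map_pow, quotMap_T]⟩
    · exact ⟨_, Or.inl (Or.inr ⟨j, hj, rfl⟩), by
        rw [map_mul, map_mul, quotMap_T, quotMap_T, quotMap_Xinv]⟩
    · exact ⟨_, Or.inr ⟨i, hi, rfl⟩, quotMap_T n u q hu i⟩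

theorem exists_restrict_of_map_eq {A B : Type*} [Ring A] [Algebra ℂ A] [Ring B] [Algebra ℂ B]
    (f : A →ₐ[ℂ] B) {S : Subalgebra ℂ A} {S' : Subalgebra ℂ B} (h : S.map f = S') :
    ∃ g : S →ₐ[ℂ] S', Function.Surjective g ∧ S'.val.comp g = f.comp S.val := by
  have hmem : ∀ x : S, (f.comp S.val) x ∈ S' := fun x => h ▸ ⟨x, x.2, rfl⟩
  refine ⟨(f.comp S.val).codRestrict S' hmem, ?_, AlgHom.ext fun _ => rfl⟩
  rintro ⟨y, hy⟩
  obtain ⟨x, hx, rfl⟩ := h ▸ hy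
  exact ⟨⟨x, hx⟩, rfl⟩

end Cyclotomic

/-- An automorphism of the affine Hecke algebra fixing all `T_i` is the identity. -/
theorem Aff.equiv_eq_one {n : ℕ} [NeZero n] {q : ℂ} (σ : Aff n q ≃ₐ[ℂ] Aff n q)
    (h : ∀ i, σ (Aff.T n q i) = Aff.T n q i) : σ = 1 := by
  have hX : σ (Aff.Xinv n q) = Aff.Xinv n q := by
    refine left_inv_eq_right_inv (a := Aff.T n q 0) ?_ (Aff.T_mul_Xinv n q)
    calc σ (Aff.Xinv n q) * Aff.T n q 0 = σ (Aff.Xinv n q) * σ (Aff.T n q 0) := by rw [h]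
      _ = 1 := by rw [← map_mul, Aff.Xinv_mul_T, map_one]
  have : (σ : Aff n q →ₐ[ℂ] Aff n q) = AlgHom.id ℂ _ := Aff.hom_ext h hX
  exact AlgEquiv.ext fun x => DFunLike.congr_fun this x

theorem Cyc.equiv_eq_one {n : ℕ} [NeZero n] {r : ℕ} {u : Fin r → ℂ} {q : ℂ}
    (σ : Cyc n u q ≃ₐ[ℂ] Cyc n u q) (h : ∀ i, σ (Cyc.T n u q i) = Cyc.T n u q i) : σ = 1 := by
  have : (σ : Cyc n u q →ₐ[ℂ] Cyc n u q) = AlgHom.id ℂ _ := Cyc.hom_ext h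
  exact AlgEquiv.ext fun x => DFunLike.congr_fun this x

end CycloHecke

end

open CycloHecke in
theorem mainTheorem1 (n r p : ℕ) [NeZero n] (hr : 0 < r) (hp : p ∣ r) (ξ q : ℂ)
    (hξ : IsPrimitiveRoot ξ p) (hq : q ≠ 0) (v : Fin (r / p) → ℂ) (u : Fin r → ℂ)
    (huv : ∀ (j : Fin r) (l : Fin (r / p)) (k : Fin p),
      (j : ℕ) = (l : ℕ) * p + (k : ℕ) → u j = ξ ^ (k : ℕ) * v l)
    (hu : ∀ j, u j ≠ 0) :
    (∏ j, (Polynomial.X - Polynomial.C (u j)) =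
      ∏ l, (Polynomial.X ^ p - Polynomial.C (v l ^ p))) ∧
    ∃ τ : Cyc n u q ≃ₐ[ℂ] Cyc n u q,
      τ (Cyc.T n u q 0) = ξ • Cyc.T n u q 0 ∧
      (∀ i : Fin n, i ≠ 0 → τ (Cyc.T n u q i) = Cyc.T n u q i) ∧
      (∀ σ : Cyc n u q →ₐ[ℂ] Cyc n u q,
        σ (Cyc.T n u q 0) = ξ • Cyc.T n u q 0 →
        (∀ i : Fin n, i ≠ 0 → σ (Cyc.T n u q i) = Cyc.T n u q i) → σ = τ) ∧
      orderOf τ = p ∧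
      (∃ ρ : Multiplicative (ZMod p) →* (Cyc n u q ≃ₐ[ℂ] Cyc n u q),
        Function.Injective ρ ∧ ρ (Multiplicative.ofAdd 1) = τ ∧
        ∀ x : Cyc n u q, x ∈ cycSub p n u q ↔ ∀ g, ρ g x = x) ∧
      orderOf (affTau n q ξ (hξ.ne_zero (Nat.pos_of_dvd_of_pos hp hr).ne')) = p ∧
      (∃ φ' : affSub p n q →ₐ[ℂ] cycSub p n u q,
        Function.Surjective φ' ∧
        (cycSub p n u q).val.comp φ' = (quotMap n u q hu).comp (affSub p n q).val) ∧
      (τ : Cyc n u q →ₐ[ℂ] Cyc n u q).comp (quotMap n u q hu) =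
        (quotMap n u q hu).comp
          (affTau n q ξ (hξ.ne_zero (Nat.pos_of_dvd_of_pos hp hr).ne') :
            Aff n q →ₐ[ℂ] Aff n q) := by
  have hp0 : 0 < p := Nat.pos_of_dvd_of_pos hp hr
  have hξ0 : ξ ≠ 0 := hξ.ne_zero hp0.ne'
  have hprod := prod_X_sub_C_eq hp0 hp hξ v u huv
  have hnt : Nontrivial (Cyc n u q) := Cyc.nontrivial hr
  have hT0 : Cyc.T n u q 0 ≠ 0 := (Cyc.isUnit_T_zero n u q hu).ne_zero
  -- `X` is nonzero because its image `T_1` under the quotient map is.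
  have hX0 : Aff.T n q 0 ≠ 0 := fun h => hT0 (by rw [← quotMap_T n u q hu, h, map_zero])
  obtain ⟨τ, hτ0, hτ⟩ := Cyc.exists_tau (n := n) (q := q) hprod hξ.pow_eq_one hξ0
  have hτinv := map_ringInverse_T_zero hu hξ0 τ.toAlgHom hτ0
  have horder : orderOf τ = p := by
    refine orderOf_eq_of_scale hξ τ hT0 hτ0 ?_
    rintro _ ⟨j, rfl⟩ h
    refine Cyc.equiv_eq_one _ fun i => ?_
    by_cases hi : i = 0
    · rw [hi, h]
    · exact pow_apply_eq_self τ (hτ i hi) j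
  have hmem := mem_cycSub_iff hp0 hξ hq hu τ hτ0 hτ
  obtain ⟨ρ, hρ, hρ1, hρfix⟩ := exists_zmod_action τ horder
  refine ⟨hprod, τ, hτ0, hτ, fun σ hσ0 hσ => ?_, horder,
    ⟨ρ, hρ, hρ1, fun x => (hmem x).trans (hρfix x).symm⟩, ?_,
    exists_restrict_of_map_eq _ (map_affSub hu ((hmem _).2 ?_)), ?_⟩
  · refine Cyc.hom_ext fun i => ?_
    by_cases hi : i = 0
    · rw [hi, hσ0]; exact hτ0.symm
    · rw [hσ i hi]; exact (hτ i hi).symm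
  · refine orderOf_eq_of_scale hξ _ hX0 (affTau_X n q ξ _) ?_
    rintro _ ⟨j, rfl⟩ h
    refine Aff.equiv_eq_one _ fun i => ?_
    by_cases hi : i = 0
    · rw [hi, h]
    · exact pow_apply_eq_self _ (affTau_T n q ξ _ i hi) j
  -- `T_1 ^ (-p)` is not among the generators of `H_{r,p,n}`. It belongs there by the fixed-point
  -- description, since `τ` scales it by `ξ ^ (-p) = 1`.
  · rw [map_pow]
    refine (congrArg (· ^ p) hτinv).trans ?_
    simp only [_root_.smul_pow, inv_pow, hξ.pow_eq_one, inv_one, one_smul]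
  · refine Aff.hom_ext (fun i => ?_) ?_
    · by_cases hi : i = 0
      · subst hi
        simp [quotMap_T, affTau_X, hτ0]
      · simp [quotMap_T, affTau_T, hi, hτ]
    · have h : affTau n q ξ hξ0 (Aff.Xinv n q) = ξ⁻¹ • Aff.Xinv n q := by
        simp [affTau, Aff.scale]
      change τ (quotMap n u q hu _) = quotMap n u q hu (affTau n q ξ hξ0 _)
      rw [h, map_smul, quotMap_Xinv]
      exact hτinv
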